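/- Let $\mathcal{C}$ be a category with pullbacks. Call a morphism $p\colon S\to T$ of $\mathcal{C}$ exponentiable if the pullback functor $p^{*}\colon \mathcal{C}/T\to\mathcal{C}/S$ has a right adjoint $\Pi_p$; the category $\mathcal{C}$ is locally Cartesian closed if every morphism is exponentiable. Let $\mathcal{P}^{\mathcal{C}}$ be the category of polynomials in $\mathcal{C}$: its objects are those of $\mathcal{C}$, and its morphisms from $X$ to $Y$ are the isomorphism classes of bispans $$X\leftarrow S\xrightarrow{\;g\;} T\to Y$$ with $g$ exponentiable, where an isomorphism of bispans is a pair of isomorphisms $S\cong S'$, $T\cong T'$ commuting with all the maps (and the identity on $X$ and $Y$). The composite of $X\leftarrow S\xrightarrow{g} T\to Y$ and $Y\leftarrow S'\xrightarrow{g'}T'\to Z$ is the class of $X\leftarrow N\to M\to P\to Z$, where $P=\Pi_{g'}(T\times_Y S')$ is formed over $T'$, $M=P\times_{T'}S'$ with its evaluation map $M\to T\times_Y S'$, $N=S\times_T M$, and the middle map is the composite $N\to M\to P$. Let $\mathcal{D}$ be a wide subcategory of $\mathcal{C}$ that is pullback stable: whenever a square in $\mathcal{C}$ is a pullback and its right vertical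 map lies in $\mathcal{D}$, so does its left vertical map. Let $\mathcal{P}^{\mathcal{C}}_{\mathcal{D}}$ be the wide subgraph of $\mathcal{P}^{\mathcal{C}}$ whose morphisms are the isomorphism classes of bispans $X\leftarrow S\xrightarrow{g}T\to Y$ with $g\in\mathcal{D}$ (and $g$ exponentiable). Then $\mathcal{P}^{\mathcal{C}}_{\mathcal{D}}$ is a (wide) subcategory of $\mathcal{P}^{\mathcal{C}}$: it contains all identities and is closed under composition. In particular this holds if $\mathcal{C}$ is locally Cartesian closed, in which case the morphisms of $\mathcal{P}^{\mathcal{C}}_{\mathcal{D}}$ are the isomorphism classes of all diagrams $X\leftarrow S\xrightarrow{g}T\to Y$ in $\mathcal{C}$ with $g\in\mathcal{D}$. -/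

import Mathlib

open CategoryTheory CategoryTheory.Limits

universe v u

namespace Polynomials

section Exponentiable

variable {C : Type u} [Category.{v} C] [HasPullbacks C]

/-- A morphism `p : A ⟶ B` is exponentiable if the pullback functor `p* : C/B ⥤ C/A` has a right
adjoint `Π_p` (the dependent product). -/
def exponentiable (C : Type u) [Category.{v} C] [HasPullbacks C] : MorphismProperty C :=
  fun _ _ p => (Over.pullback p).IsLeftAdjoint

/-- A category with pullbacks is locally Cartesian closed if for every `p` the pullback functor
`p*` has, besides its left adjoint `Σ_p`, a right adjoint `Π_p`. -/
def IsLocallyCartesianClosed (C : Type u) [Category.{v} C] [HasPullbacks C] : Prop :=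
  ∀ ⦃A B : C⦄ (p : A ⟶ B), exponentiable C p

/-- The universal property of an exponential diagram
```
A <-h- E <-e- Q
|p            |q
B <----k----- P
```
for `h : E ⟶ A` and `p : A ⟶ B`: the outer rectangle is a pullback, and it is universal among
such pullbacks. -/
structure IsExpDiagram {A B E P Q : C} (h : E ⟶ A) (p : A ⟶ B) (k : P ⟶ B) (q : Q ⟶ P)
    (e : Q ⟶ E) : Prop where
  isPullback : IsPullback (e ≫ h) q p k
  univ : ∀ {G N : C} (g : G ⟶ B) (n : N ⟶ G) (e' : N ⟶ E), IsPullback (e' ≫ h) n p g →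
    ∃! w : G ⟶ P, w ≫ k = g ∧ ∃ v : N ⟶ Q, v ≫ q = n ≫ w ∧ v ≫ e = e'

/-- For `p : A ⟶ B` exponentiable and `h : E ⟶ A`, the dependent product `Π_p E` over `B`. -/
noncomputable def depProd {A B E : C} (h : E ⟶ A) (p : A ⟶ B) (hp : exponentiable C p) :
    Over B :=
  haveI : (Over.pullback p).IsLeftAdjoint := hp
  (Over.pullback p).rightAdjoint.obj (Over.mk h)

/-- The evaluation map `Π_p E ×_B A ⟶ E`, i.e. the counit of `p* ⊣ Π_p`. -/
noncomputable def depEval {A B E : C} (h : E ⟶ A) (p : A ⟶ B) (hp : exponentiable C p) :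
    pullback (depProd h p hp).hom p ⟶ E :=
  haveI : (Over.pullback p).IsLeftAdjoint := hp
  ((Adjunction.ofIsLeftAdjoint (Over.pullback p)).counit.app (Over.mk h)).left

theorem depEval_comp {A B E : C} (h : E ⟶ A) (p : A ⟶ B) (hp : exponentiable C p) :
    depEval h p hp ≫ h = pullback.snd (depProd h p hp).hom p := by
  have : (Over.pullback p).IsLeftAdjoint := hp
  exact Over.w ((Adjunction.ofIsLeftAdjoint (Over.pullback p)).counit.app (Over.mk h))

theorem overPullback_map_fst {A B : C} (p : A ⟶ B) {K L : Over B} (ω : K ⟶ L) :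
    ((Over.pullback p).map ω).left ≫ pullback.fst L.hom p = pullback.fst K.hom p ≫ ω.left := by
  exact pullback.lift_fst _ _ _

theorem overPullback_map_snd {A B : C} (p : A ⟶ B) {K L : Over B} (ω : K ⟶ L) :
    ((Over.pullback p).map ω).left ≫ pullback.snd L.hom p = pullback.snd K.hom p := by
  exact pullback.lift_snd _ _ _

theorem isExpDiagram_depProd {A B E : C} (h : E ⟶ A) (p : A ⟶ B) (hp : exponentiable C p) :
    IsExpDiagram h p (depProd h p hp).hom (pullback.fst (depProd h p hp).hom p)
      (depEval h p hp) where
  isPullback := by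
    rw [depEval_comp]
    exact (IsPullback.of_hasPullback _ _).flip
  univ := by
    intro G N g n e' sq
    have : (Over.pullback p).IsLeftAdjoint := hp
    let adj := Adjunction.ofIsLeftAdjoint (Over.pullback p)
    let i : N ≅ pullback g p := sq.flip.isoPullback
    have i1 : i.hom ≫ pullback.fst g p = n := sq.flip.isoPullback_hom_fst
    have i2 : i.hom ≫ pullback.snd g p = e' ≫ h := sq.flip.isoPullback_hom_snd
    have j2 : i.inv ≫ e' ≫ h = pullback.snd g p := by rw [Iso.inv_comp_eq, i2]
    let φ : (Over.pullback p).obj (Over.mk g) ⟶ Over.mk h :=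
      Over.homMk (i.inv ≫ e') (by simpa using j2)
    have key : ∀ ω : Over.mk g ⟶ depProd h p hp,
        ((Over.pullback p).map ω ≫ adj.counit.app (Over.mk h) = φ ↔
          ∃ v : N ⟶ pullback (depProd h p hp).hom p,
            v ≫ pullback.fst _ _ = n ≫ ω.left ∧ v ≫ depEval h p hp = e') := by
      intro ω
      have c1 : ((Over.pullback p).map ω).left ≫ pullback.fst (depProd h p hp).hom p =
          pullback.fst g p ≫ ω.left := overPullback_map_fst p ω
      have c2 : ((Over.pullback p).map ω).left ≫ pullback.snd (depProd h p hp).hom p =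
          pullback.snd g p := overPullback_map_snd p ω
      constructor
      · intro hω
        refine ⟨i.hom ≫ ((Over.pullback p).map ω).left, ?_, ?_⟩
        · rw [Category.assoc, c1, ← Category.assoc, i1]
        · have := congrArg (fun f => i.hom ≫ f.left) hω
          have h2 : i.hom ≫ φ.left = e' := i.hom_inv_id_assoc e'
          rw [Category.assoc, ← h2]
          exact this
      · rintro ⟨v, hv1, hv2⟩
        have hv : v = i.hom ≫ ((Over.pullback p).map ω).left := by
          apply pullback.hom_ext
          · rw [hv1, Category.assoc, c1, ← Category.assoc, i1]
          · rw [Category.assoc, c2, i2, ← depEval_comp, ← Category.assoc, hv2]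
        apply Over.OverMorphism.ext
        change ((Over.pullback p).map ω).left ≫ depEval h p hp = i.inv ≫ e'
        rw [← hv2, hv]
        simp
    refine ⟨(adj.homEquiv _ _ φ).left, ⟨Over.w (adj.homEquiv _ _ φ), ?_⟩, ?_⟩
    · apply (key _).1
      have := (adj.homEquiv (Over.mk g) (Over.mk h)).symm_apply_apply φ
      rwa [adj.homEquiv_counit] at this
    · rintro w ⟨hw, hv⟩
      let ω : Over.mk g ⟶ depProd h p hp := Over.homMk w hw
      have h1 := (key ω).2 hv
      have h2 : adj.homEquiv _ _ φ = ω := by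
        apply (adj.homEquiv (Over.mk g) (Over.mk h)).symm.injective
        rw [Equiv.symm_apply_apply]
        exact (h1.symm.trans (adj.homEquiv_counit _ _ _).symm)
      rw [h2]
      rfl

theorem exists_isExpDiagram {A B E : C} (h : E ⟶ A) (p : A ⟶ B) (hp : exponentiable C p) :
    ∃ (P Q : C) (k : P ⟶ B) (q : Q ⟶ P) (e : Q ⟶ E), IsExpDiagram h p k q e :=
  ⟨_, _, _, _, _, isExpDiagram_depProd h p hp⟩

theorem exponentiable_of_isExpDiagram {A B : C} (p : A ⟶ B)
    (H : ∀ {E : C} (h : E ⟶ A), ∃ (P Q : C) (k : P ⟶ B) (q : Q ⟶ P) (e : Q ⟶ E),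
      IsExpDiagram h p k q e) : exponentiable C p := by
  have : ∀ X : Over A, HasTerminal (CostructuredArrow (Over.pullback p) X) := by
    intro X
    obtain ⟨P, Q, k, q, e, hd⟩ := H X.hom
    let i : Q ≅ pullback k p := hd.isPullback.flip.isoPullback
    have i1 : i.hom ≫ pullback.fst k p = q := hd.isPullback.flip.isoPullback_hom_fst
    have i2 : i.hom ≫ pullback.snd k p = e ≫ X.hom := hd.isPullback.flip.isoPullback_hom_snd
    let ev : (Over.pullback p).obj (Over.mk k) ⟶ X :=
      Over.homMk (i.inv ≫ e) (by
        have : i.inv ≫ e ≫ X.hom = pullback.snd k p := by rw [Iso.inv_comp_eq, i2]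
        simpa using this)
    let T : CostructuredArrow (Over.pullback p) X := CostructuredArrow.mk ev
    have key : ∀ (K : CostructuredArrow (Over.pullback p) X) (ω : K.left ⟶ Over.mk k),
        ((Over.pullback p).map ω ≫ ev = K.hom ↔
          ∃ v : pullback K.left.hom p ⟶ Q, v ≫ q = pullback.fst _ _ ≫ ω.left ∧
            v ≫ e = K.hom.left) := by
      intro K ω
      have c1 : ((Over.pullback p).map ω).left ≫ pullback.fst k p =
          pullback.fst K.left.hom p ≫ ω.left := overPullback_map_fst p ω
      have c2 : ((Over.pullback p).map ω).left ≫ pullback.snd k p =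
          pullback.snd K.left.hom p := overPullback_map_snd p ω
      constructor
      · intro hω
        refine ⟨((Over.pullback p).map ω).left ≫ i.inv, ?_, ?_⟩
        · rw [← c1, ← i1]
          simp
        · have := congrArg (fun f => f.left) hω
          simpa [ev] using this
      · rintro ⟨v, hv1, hv2⟩
        have hv : v ≫ i.hom = ((Over.pullback p).map ω).left := by
          apply pullback.hom_ext
          · rw [c1, ← hv1, Category.assoc, i1]
          · rw [c2, Category.assoc, i2, ← Category.assoc, hv2]
            exact Over.w K.hom
        apply Over.OverMorphism.ext
        change ((Over.pullback p).map ω).left ≫ i.inv ≫ e = K.hom.left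
        rw [← hv2, ← hv]
        simp
    have ex : ∀ K : CostructuredArrow (Over.pullback p) X,
        ∃! w : K.left.left ⟶ P, w ≫ k = K.left.hom ∧ ∃ v : pullback K.left.hom p ⟶ Q,
          v ≫ q = pullback.fst _ _ ≫ w ∧ v ≫ e = K.hom.left := by
      intro K
      apply hd.univ
      have : K.hom.left ≫ X.hom = pullback.snd K.left.hom p := Over.w K.hom
      rw [this]
      exact (IsPullback.of_hasPullback _ _).flip
    choose w hw hu using ex
    refine IsTerminal.hasTerminal (X := T) (IsTerminal.ofUniqueHom
      (fun K => CostructuredArrow.homMk (Over.homMk (w K) (hw K).1)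
        ((key K _).2 (hw K).2)) ?_)
    intro K m
    have h1 : m.left.left = w K := hu K _ ⟨Over.w m.left, (key K m.left).1 (CostructuredArrow.w m)⟩
    apply CostructuredArrow.hom_ext
    apply Over.OverMorphism.ext
    exact h1
  exact isLeftAdjoint_of_costructuredArrowTerminals _

instance : (exponentiable C).IsMultiplicative where
  id_mem X := Functor.isLeftAdjoint_of_iso (Over.pullbackId (X := X)).symm
  comp_mem f g hf hg := by
    have : (Over.pullback f).IsLeftAdjoint := hf
    have : (Over.pullback g).IsLeftAdjoint := hg
    exact Functor.isLeftAdjoint_of_iso (Over.pullbackComp f g).symm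

instance : (exponentiable C).IsStableUnderBaseChange where
  of_isPullback := by
    intro B' A A' B f p f' p' sq hp
    apply exponentiable_of_isExpDiagram
    intro E h
    obtain ⟨P1, Q1, k1, q1, e1, D1⟩ := exists_isExpDiagram (h ≫ f') p hp
    obtain ⟨P2, Q2, k2, q2, e2, D2⟩ := exists_isExpDiagram f' p hp
    obtain ⟨α, ⟨hα, v1, hv1q, hv1e⟩, -⟩ := D2.univ k1 q1 (e1 ≫ h)
      (by simpa using D1.isPullback)
    obtain ⟨β, ⟨hβ, v2, hv2q, hv2e⟩, -⟩ := D2.univ f p' (𝟙 A') (by simpa using sq)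
    have hc : pullback.fst α β ≫ α = pullback.snd α β ≫ β := pullback.condition
    have hQ : pullback.fst q1 (pullback.fst α β) ≫ q1 =
      pullback.snd q1 (pullback.fst α β) ≫ pullback.fst α β := pullback.condition
    have hk : pullback.fst α β ≫ k1 = pullback.snd α β ≫ f := by
      rw [← hα, ← hβ, reassoc_of% hc]
    have big := (IsPullback.of_hasPullback q1 (pullback.fst α β)).paste_horiz D1.isPullback
    rw [hk] at big
    refine ⟨pullback α β, pullback q1 (pullback.fst α β), pullback.snd _ _, pullback.snd _ _,
      pullback.fst _ _ ≫ e1, ?_, ?_⟩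
    · have comm : ((pullback.fst q1 (pullback.fst α β) ≫ e1) ≫ h) ≫ p' =
          pullback.snd q1 (pullback.fst α β) ≫ pullback.snd α β := by
        let t := sq.lift (pullback.fst q1 (pullback.fst α β) ≫ e1 ≫ h ≫ f')
          (pullback.snd q1 (pullback.fst α β) ≫ pullback.snd α β)
          (by simpa using big.w)
        have t1 : t ≫ f' = _ := sq.lift_fst _ _ _
        have t2 : t ≫ p' = _ := sq.lift_snd _ _ _
        have ht : pullback.fst q1 (pullback.fst α β) ≫ v1 = t ≫ v2 := by
          apply D2.isPullback.hom_ext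
          · rw [Category.assoc, Category.assoc, reassoc_of% hv1e, reassoc_of% hv2e, t1]
          · rw [Category.assoc, Category.assoc, hv1q, hv2q, reassoc_of% hQ, reassoc_of% t2, hc]
        have ht' := congrArg (fun m => m ≫ e2) ht
        simp only [Category.assoc, hv1e, hv2e, Category.comp_id] at ht'
        rw [← t2, ← ht', Category.assoc, Category.assoc, Category.assoc, Category.assoc]
      exact IsPullback.of_right (by simpa using big) comm sq
    · intro G N g n e' hN
      have hN' := hN.paste_horiz sq
      obtain ⟨w1, ⟨hw1, v, hvq, hve⟩, hu⟩ := D1.univ (g ≫ f) n e' (by simpa using hN')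
      have hw : w1 ≫ α = g ≫ β := by
        refine (D2.univ (g ≫ f) n (e' ≫ h) hN').unique ⟨?_, v ≫ v1, ?_, ?_⟩
          ⟨?_, (e' ≫ h) ≫ v2, ?_, ?_⟩
        · rw [Category.assoc, hα, hw1]
        · rw [Category.assoc, hv1q, reassoc_of% hvq]
        · rw [Category.assoc, hv1e, reassoc_of% hve]
        · rw [Category.assoc, hβ]
        · rw [Category.assoc, hv2q, ← Category.assoc, hN.w, Category.assoc]
        · rw [Category.assoc, hv2e, Category.comp_id]
      refine ⟨pullback.lift w1 g hw, ⟨pullback.lift_snd _ _ _, pullback.lift v (n ≫ pullback.lift w1 g hw)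
        (by rw [hvq, Category.assoc, pullback.lift_fst]), pullback.lift_snd _ _ _,
        by rw [← Category.assoc, pullback.lift_fst, hve]⟩, ?_⟩
      rintro w' ⟨hw', v', hv'q, hv'e⟩
      apply pullback.hom_ext
      · rw [pullback.lift_fst]
        refine hu _ ⟨?_, v' ≫ pullback.fst _ _, ?_, ?_⟩
        · rw [Category.assoc, hk, reassoc_of% hw']
        · rw [Category.assoc, hQ, reassoc_of% hv'q]
        · rw [Category.assoc, hv'e]
      · rw [pullback.lift_snd, hw']

end Exponentiable

section Bispans

variable {C : Type u} [Category.{v} C] [HasPullbacks C]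

/-- A bispan (polynomial diagram) `X <-s- E -p-> B -t-> Y` with exponentiable middle map `p`. -/
structure Bispan (X Y : C) where
  E : C
  B : C
  s : E ⟶ X
  p : E ⟶ B
  t : B ⟶ Y
  exp : exponentiable C p

namespace Bispan

/-- Every diagram `X <- E -> B -> Y` in a locally Cartesian closed category is a bispan. -/
def ofLCC (hC : IsLocallyCartesianClosed C) {X Y E B : C} (s : E ⟶ X) (p : E ⟶ B) (t : B ⟶ Y) :
    Bispan X Y :=
  ⟨E, B, s, p, t, hC p⟩

/-- An isomorphism of bispans, the identity on both ends. -/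
structure Iso {X Y : C} (F G : Bispan X Y) where
  eE : F.E ≅ G.E
  eB : F.B ≅ G.B
  hs : eE.hom ≫ G.s = F.s
  hp : eE.hom ≫ G.p = F.p ≫ eB.hom
  ht : eB.hom ≫ G.t = F.t

/-- Isomorphism of bispans is an equivalence relation. -/
instance setoid (X Y : C) : Setoid (Bispan X Y) where
  r F G := Nonempty (Iso F G)
  iseqv :=
    { refl := fun F => ⟨⟨CategoryTheory.Iso.refl _, CategoryTheory.Iso.refl _, by simp, by simp,
        by simp⟩⟩
      symm := by
        rintro F G ⟨i⟩
        refine ⟨⟨i.eE.symm, i.eB.symm, ?_, ?_, ?_⟩⟩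
        · simp [← i.hs]
        · have h := reassoc_of% i.hp
          simp [CategoryTheory.Iso.inv_comp_eq, h]
        · simp [← i.ht]
      trans := by
        rintro F G H ⟨i⟩ ⟨j⟩
        refine ⟨⟨i.eE ≪≫ j.eE, i.eB ≪≫ j.eB, ?_, ?_, ?_⟩⟩
        · simp [i.hs, j.hs]
        · simp [j.hp, reassoc_of% i.hp]
        · simp [i.ht, j.ht] }

/-- The identity bispan `X = X = X = X`. -/
abbrev id (X : C) : Bispan X X :=
  ⟨X, X, 𝟙 X, 𝟙 X, 𝟙 X, (exponentiable C).id_mem X⟩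

/-! ### Composition

For `F = (X <- E -p-> B -> Y)` and `G = (Y <- E' -p'-> B' -> Z)`, the composite `G ∘ F` is the outer
bispan of
```
      N -n->  M  -m-->  P
      |        |eps       |
      |      B×_Y E'      |
      |      /    \       |
      E -p-> B     E'-p'-> B'
```
where `P = Π_{p'} (B ×_Y E')`, `M = P ×_{B'} E'` (so that `M, P, eps` form an exponential diagram on
`B ×_Y E' -> E' -p'-> B'`), and `N = E ×_B M`. -/

section comp

variable {X Y Z : C} (F : Bispan X Y) (G : Bispan Y Z)

/-- The dependent product `P = Π_{p'} (B ×_Y E')`, over `B'`. -/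
noncomputable def compP : Over G.B :=
  depProd (pullback.snd F.t G.s) G.p G.exp

/-- `M = P ×_{B'} E'`. -/
noncomputable abbrev compM : C := pullback (compP F G).hom G.p

/-- The projection `M ⟶ P`, a base change of `p'`. -/
noncomputable abbrev compm : compM F G ⟶ (compP F G).left := pullback.fst (compP F G).hom G.p

/-- The map `M ⟶ B ×_Y E'` of the exponential diagram. -/
noncomputable def compEps : compM F G ⟶ pullback F.t G.s :=
  depEval (pullback.snd F.t G.s) G.p G.exp

theorem isExpDiagram_comp :
    IsExpDiagram (pullback.snd F.t G.s) G.p (compP F G).hom (compm F G) (compEps F G) :=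
  isExpDiagram_depProd _ _ _

/-- `N = E ×_B M`. -/
noncomputable abbrev compN : C := pullback F.p (compEps F G ≫ pullback.fst F.t G.s)

/-- The projection `N ⟶ M`, a base change of `p`. -/
noncomputable abbrev compn : compN F G ⟶ compM F G :=
  pullback.snd F.p (compEps F G ≫ pullback.fst F.t G.s)

theorem exponentiable_comp : exponentiable C (compn F G ≫ compm F G) :=
  (exponentiable C).comp_mem _ _
    (MorphismProperty.of_isPullback (IsPullback.of_hasPullback F.p _) F.exp)
    (MorphismProperty.of_isPullback (isExpDiagram_comp F G).isPullback G.exp)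

/-- The composite of two bispans, in diagrammatic order. -/
noncomputable def comp : Bispan X Z where
  E := compN F G
  B := (compP F G).left
  s := pullback.fst F.p (compEps F G ≫ pullback.fst F.t G.s) ≫ F.s
  p := compn F G ≫ compm F G
  t := (compP F G).hom ≫ G.t
  exp := exponentiable_comp F G

end comp

/-! ### The universal property of the composite -/

/-- A factorization of an arrow `N ⟶ P` through `M`, with cartesian squares to the middle maps of
`F` and of `G`, compatible over `Y`. The composite of `F` and `G` is the terminal one. -/
structure CompData {X Y Z : C} (F : Bispan X Y) (G : Bispan Y Z) where
  N : C
  M : C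
  P : C
  n : N ⟶ M
  m : M ⟶ P
  a : N ⟶ F.E
  b : M ⟶ F.B
  c : M ⟶ G.E
  d : P ⟶ G.B
  left : IsPullback a n F.p b
  right : IsPullback c m G.p d
  w : b ≫ F.t = c ≫ G.s

namespace CompData

variable {X Y Z : C} {F : Bispan X Y} {G : Bispan Y Z}

@[ext]
structure Hom (K L : CompData F G) where
  u : K.N ⟶ L.N
  v : K.M ⟶ L.M
  w : K.P ⟶ L.P
  hn : u ≫ L.n = K.n ≫ v
  hm : v ≫ L.m = K.m ≫ w
  ha : u ≫ L.a = K.a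
  hb : v ≫ L.b = K.b
  hc : v ≫ L.c = K.c
  hd : w ≫ L.d = K.d

instance : Category (CompData F G) where
  Hom K L := Hom K L
  id K := ⟨𝟙 _, 𝟙 _, 𝟙 _, by simp, by simp, by simp, by simp, by simp, by simp⟩
  comp f g := ⟨f.u ≫ g.u, f.v ≫ g.v, f.w ≫ g.w,
    by rw [Category.assoc, g.hn, reassoc_of% f.hn], by rw [Category.assoc, g.hm, reassoc_of% f.hm],
    by rw [Category.assoc, g.ha, f.ha], by rw [Category.assoc, g.hb, f.hb],
    by rw [Category.assoc, g.hc, f.hc], by rw [Category.assoc, g.hd, f.hd]⟩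
  id_comp f := Hom.ext (Category.id_comp f.u) (Category.id_comp f.v) (Category.id_comp f.w)
  comp_id f := Hom.ext (Category.comp_id f.u) (Category.comp_id f.v) (Category.comp_id f.w)
  assoc f g h := Hom.ext (Category.assoc f.u g.u h.u) (Category.assoc f.v g.v h.v)
    (Category.assoc f.w g.w h.w)

/-- The outer bispan of a `CompData`. -/
abbrev toBispan (K : CompData F G) : Bispan X Z where
  E := K.N
  B := K.P
  s := K.a ≫ F.s
  p := K.n ≫ K.m
  t := K.d ≫ G.t
  exp := (exponentiable C).comp_mem _ _ (MorphismProperty.of_isPullback K.left F.exp)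
    (MorphismProperty.of_isPullback K.right G.exp)

/-- Morphisms of `CompData` consist of cartesian squares. -/
theorem Hom.isPullback_left {K L : CompData F G} (f : Hom K L) : IsPullback f.u K.n L.n f.v :=
  IsPullback.of_right (by rw [f.ha, f.hb]; exact K.left) f.hn L.left

theorem Hom.isPullback_right {K L : CompData F G} (f : Hom K L) : IsPullback f.v K.m L.m f.w :=
  IsPullback.of_right (by rw [f.hc, f.hd]; exact K.right) f.hm L.right

theorem iso_of_isTerminal {S T : CompData F G} (hS : IsTerminal S) (hT : IsTerminal T) :
    S.toBispan ≈ T.toBispan := by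
  let i := hS.uniqueUpToIso hT
  refine ⟨⟨⟨i.hom.u, i.inv.u, congrArg Hom.u i.hom_inv_id, congrArg Hom.u i.inv_hom_id⟩,
    ⟨i.hom.w, i.inv.w, congrArg Hom.w i.hom_inv_id, congrArg Hom.w i.inv_hom_id⟩, ?_, ?_, ?_⟩⟩
  · change i.hom.u ≫ T.a ≫ F.s = S.a ≫ F.s
    rw [← Category.assoc, i.hom.ha]
  · change i.hom.u ≫ T.n ≫ T.m = (S.n ≫ S.m) ≫ i.hom.w
    rw [← Category.assoc, i.hom.hn, Category.assoc, i.hom.hm, Category.assoc]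
  · change i.hom.w ≫ T.d ≫ G.t = S.d ≫ G.t
    rw [← Category.assoc, i.hom.hd]

end CompData

/-- The data defining the composite. -/
noncomputable abbrev compData {X Y Z : C} (F : Bispan X Y) (G : Bispan Y Z) : CompData F G where
  N := compN F G
  M := compM F G
  P := (compP F G).left
  n := compn F G
  m := compm F G
  a := pullback.fst F.p (compEps F G ≫ pullback.fst F.t G.s)
  b := compEps F G ≫ pullback.fst F.t G.s
  c := compEps F G ≫ pullback.snd F.t G.s
  d := (compP F G).hom
  left := IsPullback.of_hasPullback _ _
  right := (isExpDiagram_comp F G).isPullback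
  w := by rw [Category.assoc, pullback.condition, Category.assoc]

theorem compData_isTerminal {X Y Z : C} (F : Bispan X Y) (G : Bispan Y Z) :
    Nonempty (IsTerminal (compData F G)) := by
  have key : ∀ K : CompData F G, ∃! f : CompData.Hom K (compData F G), True := by
    intro K
    have hK : pullback.lift K.b K.c K.w ≫ pullback.snd F.t G.s = K.c := pullback.lift_snd _ _ _
    obtain ⟨w, ⟨hw, v, hvm, hve⟩, hu⟩ := (isExpDiagram_comp F G).univ K.d K.m
      (pullback.lift K.b K.c K.w) (by rw [hK]; exact K.right)
    have hb : v ≫ (compData F G).b = K.b := by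
      change v ≫ compEps F G ≫ _ = _
      rw [reassoc_of% hve, pullback.lift_fst]
    have hc : v ≫ (compData F G).c = K.c := by
      change v ≫ compEps F G ≫ _ = _
      rw [reassoc_of% hve, pullback.lift_snd]
    refine ⟨⟨(compData F G).left.lift K.a (K.n ≫ v) (by rw [Category.assoc, hb, K.left.w]), v, w,
      (compData F G).left.lift_snd _ _ _, hvm, (compData F G).left.lift_fst _ _ _, hb, hc, hw⟩,
      trivial, ?_⟩
    rintro g -
    have h1 : g.w = w := by
      refine hu _ ⟨g.hd, g.v, g.hm, ?_⟩
      apply pullback.hom_ext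
      · rw [pullback.lift_fst, Category.assoc]
        exact g.hb
      · rw [pullback.lift_snd, Category.assoc]
        exact g.hc
    have h2 : g.v = v := by
      apply (compData F G).right.hom_ext
      · rw [g.hc, hc]
      · rw [g.hm, h1]
        exact hvm.symm
    refine CompData.Hom.ext ?_ h2 h1
    apply (compData F G).left.hom_ext
    · rw [g.ha, IsPullback.lift_fst]
    · rw [g.hn, IsPullback.lift_snd, h2]
  choose f hf using key
  exact ⟨IsTerminal.ofUniqueHom f (fun K g => (hf K).2 g trivial)⟩

/-- Any terminal `CompData` computes the composite. -/
theorem comp_equiv {X Y Z : C} {F : Bispan X Y} {G : Bispan Y Z} {T : CompData F G}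
    (hT : IsTerminal T) : comp F G ≈ T.toBispan :=
  CompData.iso_of_isTerminal (compData_isTerminal F G).some hT

theorem id_comp_equiv {X Y : C} (F : Bispan X Y) : comp (id X) F ≈ F := by
  let T : CompData (id X) F :=
    { N := F.E, M := F.E, P := F.B, n := 𝟙 _, m := F.p, a := F.s, b := F.s, c := 𝟙 _, d := 𝟙 _
      left := IsPullback.of_vert_isIso ⟨by simp [id]⟩
      right := IsPullback.of_horiz_isIso ⟨by simp⟩
      w := by simp [id] }
  have hT : IsTerminal T := IsTerminal.ofUniqueHom
    (fun K => ⟨K.n ≫ K.c, K.c, K.d, by simp [T], by simp [T, K.right.w], by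
      have h1 := K.left.w
      have h2 := K.w
      simp only [id, Category.comp_id] at h1 h2
      simp [T, ← h2, h1], by
      have h2 := K.w
      simp only [id, Category.comp_id] at h2
      simp [T, h2], by simp [T], by simp [T]⟩)
    (fun K g => by
      have h1 := g.hn
      have h2 := g.hc
      have h3 := g.hd
      simp only [T, Category.comp_id] at h1 h2 h3
      exact CompData.Hom.ext (by rw [h1, h2]) h2 h3)
  refine Setoid.trans (comp_equiv hT) ⟨⟨CategoryTheory.Iso.refl _, CategoryTheory.Iso.refl _, ?_, ?_, ?_⟩⟩
  · simp [T, CompData.toBispan, id]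
  · simp [T, CompData.toBispan]
  · simp [T, CompData.toBispan]

theorem comp_id_equiv {X Y : C} (F : Bispan X Y) : comp F (id Y) ≈ F := by
  let T : CompData F (id Y) :=
    { N := F.E, M := F.B, P := F.B, n := F.p, m := 𝟙 _, a := 𝟙 _, b := 𝟙 _, c := F.t, d := F.t
      left := IsPullback.of_horiz_isIso ⟨by simp⟩
      right := IsPullback.of_vert_isIso ⟨by simp [id]⟩
      w := by simp [id] }
  have hm : ∀ K : CompData F (id Y), IsIso K.m := fun K => K.right.isIso_snd_of_isIso
  have hT : IsTerminal T := IsTerminal.ofUniqueHom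
    (fun K => ⟨K.a, K.b, inv K.m ≫ K.b, by simp [T, K.left.w], by simp [T], by simp [T],
      by simp [T], by simp [T, K.w, id], by
        have h1 := K.right.w
        have h2 := K.w
        simp only [id, Category.comp_id] at h1 h2
        simp [T, h2, h1]⟩)
    (fun K g => by
      have h1 := g.ha
      have h2 := g.hb
      have h3 := g.hm
      simp only [T, Category.comp_id] at h1 h2 h3
      exact CompData.Hom.ext h1 h2 ((IsIso.eq_inv_comp _).2 (by rw [← h3, h2])))
  refine Setoid.trans (comp_equiv hT) ⟨⟨CategoryTheory.Iso.refl _, CategoryTheory.Iso.refl _, ?_, ?_, ?_⟩⟩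
  · simp [T, CompData.toBispan]
  · simp [T, CompData.toBispan]
  · simp [T, CompData.toBispan, id]

/-- Composition respects isomorphism of bispans. -/
theorem comp_congr {X Y Z : C} {F F' : Bispan X Y} {G G' : Bispan Y Z} (hF : F ≈ F')
    (hG : G ≈ G') : comp F G ≈ comp F' G' := by
  obtain ⟨i⟩ := hF
  obtain ⟨j⟩ := hG
  have his : i.eE.inv ≫ F.s = F'.s := by rw [Iso.inv_comp_eq, i.hs]
  have hit : i.eB.inv ≫ F.t = F'.t := by rw [Iso.inv_comp_eq, i.ht]
  have hip : i.eE.inv ≫ F.p = F'.p ≫ i.eB.inv := by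
    rw [Iso.inv_comp_eq, ← Category.assoc, i.hp, Category.assoc, Iso.hom_inv_id, Category.comp_id]
  have hjs : j.eE.inv ≫ G.s = G'.s := by rw [Iso.inv_comp_eq, j.hs]
  have hjp : j.eE.inv ≫ G.p = G'.p ≫ j.eB.inv := by
    rw [Iso.inv_comp_eq, ← Category.assoc, j.hp, Category.assoc, Iso.hom_inv_id, Category.comp_id]
  obtain ⟨hT⟩ := compData_isTerminal F G
  generalize compData F G = T at hT
  let push (K : CompData F G) : CompData F' G' :=
    { N := K.N, M := K.M, P := K.P, n := K.n, m := K.m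
      a := K.a ≫ i.eE.hom, b := K.b ≫ i.eB.hom, c := K.c ≫ j.eE.hom, d := K.d ≫ j.eB.hom
      left := K.left.paste_horiz (IsPullback.of_horiz_isIso ⟨i.hp⟩)
      right := K.right.paste_horiz (IsPullback.of_horiz_isIso ⟨j.hp⟩)
      w := by simp [i.ht, j.hs, K.w] }
  let pull (K : CompData F' G') : CompData F G :=
    { N := K.N, M := K.M, P := K.P, n := K.n, m := K.m
      a := K.a ≫ i.eE.inv, b := K.b ≫ i.eB.inv, c := K.c ≫ j.eE.inv, d := K.d ≫ j.eB.inv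
      left := K.left.paste_horiz (IsPullback.of_horiz_isIso ⟨hip⟩)
      right := K.right.paste_horiz (IsPullback.of_horiz_isIso ⟨hjp⟩)
      w := by simp [hit, hjs, K.w] }
  let adj (K : CompData F' G') (f : CompData.Hom (pull K) T) : CompData.Hom K (push T) :=
    ⟨f.u, f.v, f.w, f.hn, f.hm, by simp [push, reassoc_of% f.ha, pull],
      by simp [push, reassoc_of% f.hb, pull], by simp [push, reassoc_of% f.hc, pull],
      by simp [push, reassoc_of% f.hd, pull]⟩
  let adj' (K : CompData F' G') (f : CompData.Hom K (push T)) : CompData.Hom (pull K) T :=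
    ⟨f.u, f.v, f.w, f.hn, f.hm, by simp [pull, ← f.ha, push], by simp [pull, ← f.hb, push],
      by simp [pull, ← f.hc, push], by simp [pull, ← f.hd, push]⟩
  have hT' : IsTerminal (push T) := IsTerminal.ofUniqueHom
    (fun K => adj K (hT.from (pull K)))
    (fun K g => by
      have := hT.hom_ext (adj' K g) (hT.from (pull K))
      exact congrArg (adj K) this)
  refine Setoid.trans (comp_equiv hT) (Setoid.trans ?_ (Setoid.symm (comp_equiv hT')))
  refine ⟨⟨CategoryTheory.Iso.refl _, CategoryTheory.Iso.refl _, ?_, ?_, ?_⟩⟩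
  · simp [push, CompData.toBispan, i.hs]
  · simp [push, CompData.toBispan]
  · simp [push, CompData.toBispan, j.ht]

/-! ### Associativity -/

/-- The analogue of `CompData` for three bispans. -/
structure TriData {W X Y Z : C} (F : Bispan W X) (G : Bispan X Y) (H : Bispan Y Z) where
  N : C
  L : C
  M : C
  P : C
  n : N ⟶ L
  l : L ⟶ M
  m : M ⟶ P
  a : N ⟶ F.E
  b : L ⟶ F.B
  c : L ⟶ G.E
  d : M ⟶ G.B
  e : M ⟶ H.E
  f : P ⟶ H.B
  pbF : IsPullback a n F.p b
  pbG : IsPullback c l G.p d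
  pbH : IsPullback e m H.p f
  w : b ≫ F.t = c ≫ G.s
  w' : d ≫ G.t = e ≫ H.s

namespace TriData

variable {W X Y Z : C} {F : Bispan W X} {G : Bispan X Y} {H : Bispan Y Z}

@[ext]
structure Hom (K T : TriData F G H) where
  u : K.N ⟶ T.N
  v : K.L ⟶ T.L
  x : K.M ⟶ T.M
  y : K.P ⟶ T.P
  hn : u ≫ T.n = K.n ≫ v
  hl : v ≫ T.l = K.l ≫ x
  hm : x ≫ T.m = K.m ≫ y
  ha : u ≫ T.a = K.a
  hb : v ≫ T.b = K.b
  hc : v ≫ T.c = K.c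
  hd : x ≫ T.d = K.d
  he : x ≫ T.e = K.e
  hf : y ≫ T.f = K.f

instance : Category (TriData F G H) where
  Hom K T := Hom K T
  id K := ⟨𝟙 _, 𝟙 _, 𝟙 _, 𝟙 _, by simp, by simp, by simp, by simp, by simp, by simp, by simp,
    by simp, by simp⟩
  comp f g := ⟨f.u ≫ g.u, f.v ≫ g.v, f.x ≫ g.x, f.y ≫ g.y,
    by rw [Category.assoc, g.hn, reassoc_of% f.hn], by rw [Category.assoc, g.hl, reassoc_of% f.hl],
    by rw [Category.assoc, g.hm, reassoc_of% f.hm],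
    by rw [Category.assoc, g.ha, f.ha], by rw [Category.assoc, g.hb, f.hb],
    by rw [Category.assoc, g.hc, f.hc], by rw [Category.assoc, g.hd, f.hd],
    by rw [Category.assoc, g.he, f.he], by rw [Category.assoc, g.hf, f.hf]⟩
  id_comp f := Hom.ext (Category.id_comp f.u) (Category.id_comp f.v) (Category.id_comp f.x)
    (Category.id_comp f.y)
  comp_id f := Hom.ext (Category.comp_id f.u) (Category.comp_id f.v) (Category.comp_id f.x)
    (Category.comp_id f.y)
  assoc f g h := Hom.ext (Category.assoc f.u g.u h.u) (Category.assoc f.v g.v h.v)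
    (Category.assoc f.x g.x h.x) (Category.assoc f.y g.y h.y)

/-- The outer bispan of a `TriData`. -/
abbrev toBispan (K : TriData F G H) : Bispan W Z where
  E := K.N
  B := K.P
  s := K.a ≫ F.s
  p := K.n ≫ K.l ≫ K.m
  t := K.f ≫ H.t
  exp := (exponentiable C).comp_mem _ _ (MorphismProperty.of_isPullback K.pbF F.exp)
    ((exponentiable C).comp_mem _ _ (MorphismProperty.of_isPullback K.pbG G.exp)
      (MorphismProperty.of_isPullback K.pbH H.exp))

theorem iso_of_isTerminal {S T : TriData F G H} (hS : IsTerminal S) (hT : IsTerminal T) :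
    S.toBispan ≈ T.toBispan := by
  let i := hS.uniqueUpToIso hT
  refine ⟨⟨⟨i.hom.u, i.inv.u, congrArg Hom.u i.hom_inv_id, congrArg Hom.u i.inv_hom_id⟩,
    ⟨i.hom.y, i.inv.y, congrArg Hom.y i.hom_inv_id, congrArg Hom.y i.inv_hom_id⟩, ?_, ?_, ?_⟩⟩
  · change i.hom.u ≫ T.a ≫ F.s = S.a ≫ F.s
    rw [← Category.assoc, i.hom.ha]
  · change i.hom.u ≫ T.n ≫ T.l ≫ T.m = (S.n ≫ S.l ≫ S.m) ≫ i.hom.y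
    rw [reassoc_of% i.hom.hn, reassoc_of% i.hom.hl, i.hom.hm, Category.assoc, Category.assoc]
  · change i.hom.y ≫ T.f ≫ H.t = S.f ≫ H.t
    rw [← Category.assoc, i.hom.hf]

end TriData

/-- `(F ; G) ; H` is the outer bispan of a terminal `TriData`. -/
theorem exists_triData_left {W X Y Z : C} (F : Bispan W X) (G : Bispan X Y) (H : Bispan Y Z) :
    ∃ T : TriData F G H, Nonempty (IsTerminal T) ∧ comp (comp F G) H ≈ T.toBispan := by
  obtain ⟨hT⟩ := compData_isTerminal F G
  have hFG : comp F G = (compData F G).toBispan := rfl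
  rw [hFG]
  generalize compData F G = T at hT
  obtain ⟨hS⟩ := compData_isTerminal T.toBispan H
  have hTH : comp T.toBispan H = (compData T.toBispan H).toBispan := rfl
  rw [hTH]
  generalize compData T.toBispan H = S at hS
  have hSl : IsPullback (S.a : S.N ⟶ T.N) S.n (T.n ≫ T.m) (S.b : S.M ⟶ T.P) := S.left
  have hL := IsPullback.of_hasPullback (S.b : S.M ⟶ T.P) T.m
  let n : S.N ⟶ pullback (S.b : S.M ⟶ T.P) T.m :=
    pullback.lift S.n (S.a ≫ T.n) (by rw [← hSl.w, Category.assoc])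
  have hn1 : n ≫ pullback.fst _ _ = S.n := pullback.lift_fst _ _ _
  have hn2 : n ≫ pullback.snd _ _ = S.a ≫ T.n := pullback.lift_snd _ _ _
  have hN : IsPullback (S.a : S.N ⟶ T.N) n T.n (pullback.snd (S.b : S.M ⟶ T.P) T.m) :=
    IsPullback.of_bot (by rw [hn1]; exact hSl) hn2.symm hL.flip
  let R : TriData F G H :=
    { N := S.N, L := pullback (S.b : S.M ⟶ T.P) T.m, M := S.M, P := S.P
      n := n, l := pullback.fst _ _, m := S.m
      a := S.a ≫ T.a, b := pullback.snd _ _ ≫ T.b, c := pullback.snd _ _ ≫ T.c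
      d := S.b ≫ T.d, e := S.c, f := S.d
      pbF := hN.paste_horiz T.left
      pbG := hL.flip.paste_horiz T.right
      pbH := S.right
      w := by rw [Category.assoc, T.w, Category.assoc]
      w' := by
        rw [Category.assoc]
        exact S.w }
  have key : ∀ K : TriData F G H, ∃! g : TriData.Hom K R, True := by
    intro K
    let K1 : CompData F G := ⟨K.N, K.L, K.M, K.n, K.l, K.a, K.b, K.c, K.d, K.pbF, K.pbG, K.w⟩
    let φ : CompData.Hom K1 T := hT.from K1
    have sq := (φ.isPullback_left.paste_vert φ.isPullback_right)
    let K2 : CompData T.toBispan H := ⟨K.N, K.M, K.P, K.n ≫ K.l, K.m, φ.u, φ.w, K.e, K.f, sq, K.pbH,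
      by
        change φ.w ≫ T.d ≫ G.t = _
        rw [← Category.assoc, φ.hd, ← K.w']⟩
    let ψ : CompData.Hom K2 S := hS.from K2
    have hψn : ψ.u ≫ S.n = (K.n ≫ K.l) ≫ ψ.v := ψ.hn
    have hψa : ψ.u ≫ S.a = φ.u := ψ.ha
    have hψb : ψ.v ≫ S.b = φ.w := ψ.hb
    have hφm : φ.v ≫ T.m = K.l ≫ φ.w := φ.hm
    have hφn : φ.u ≫ T.n = K.n ≫ φ.v := φ.hn
    have hφa : φ.u ≫ T.a = K.a := φ.ha
    have hφb : φ.v ≫ T.b = K.b := φ.hb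
    have hφc : φ.v ≫ T.c = K.c := φ.hc
    have hφd : φ.w ≫ T.d = K.d := φ.hd
    let q : K.L ⟶ pullback (S.b : S.M ⟶ T.P) T.m :=
      pullback.lift (K.l ≫ ψ.v) φ.v (by rw [Category.assoc, hψb, hφm])
    have hq1 : q ≫ pullback.fst _ _ = K.l ≫ ψ.v := pullback.lift_fst _ _ _
    have hq2 : q ≫ pullback.snd _ _ = φ.v := pullback.lift_snd _ _ _
    refine ⟨⟨ψ.u, q, ψ.v, ψ.w, ?_, hq1, ψ.hm, ?_, ?_, ?_, ?_, ψ.hc, ψ.hd⟩, trivial, ?_⟩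
    · change ψ.u ≫ n = K.n ≫ q
      apply pullback.hom_ext
      · rw [Category.assoc, Category.assoc, hn1, hq1, hψn, Category.assoc]
      · rw [Category.assoc, Category.assoc, hn2, hq2, reassoc_of% hψa, hφn]
    · change ψ.u ≫ S.a ≫ T.a = K.a
      rw [reassoc_of% hψa, hφa]
    · change q ≫ pullback.snd _ _ ≫ T.b = K.b
      rw [reassoc_of% hq2, hφb]
    · change q ≫ pullback.snd _ _ ≫ T.c = K.c
      rw [reassoc_of% hq2, hφc]
    · change ψ.v ≫ S.b ≫ T.d = K.d
      rw [reassoc_of% hψb, hφd]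
    · rintro χ -
      have χn : χ.u ≫ n = K.n ≫ χ.v := χ.hn
      have χl : χ.v ≫ pullback.fst _ _ = K.l ≫ χ.x := χ.hl
      have χa : χ.u ≫ S.a ≫ T.a = K.a := χ.ha
      have χb : χ.v ≫ pullback.snd _ _ ≫ T.b = K.b := χ.hb
      have χc : χ.v ≫ pullback.snd _ _ ≫ T.c = K.c := χ.hc
      have χd : χ.x ≫ S.b ≫ T.d = K.d := χ.hd
      let φ' : CompData.Hom K1 T := ⟨χ.u ≫ S.a, χ.v ≫ pullback.snd _ _, χ.x ≫ S.b,
        by rw [Category.assoc, ← hn2, reassoc_of% χn],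
        by rw [Category.assoc, ← pullback.condition, reassoc_of% χl],
        by rw [Category.assoc, χa], by rw [Category.assoc, χb], by rw [Category.assoc, χc],
        by rw [Category.assoc, χd]⟩
      have hφ' : φ' = φ := hT.hom_ext φ' φ
      have e1 : χ.u ≫ S.a = φ.u := congrArg CompData.Hom.u hφ'
      have e2 : χ.v ≫ pullback.snd _ _ = φ.v := congrArg CompData.Hom.v hφ'
      have e3 : χ.x ≫ S.b = φ.w := congrArg CompData.Hom.w hφ'
      let ψ' : CompData.Hom K2 S := ⟨χ.u, χ.x, χ.y,
        by
          change _ = (K.n ≫ K.l) ≫ χ.x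
          rw [← hn1, reassoc_of% χn, χl, Category.assoc],
        χ.hm, e1, e3, χ.he, χ.hf⟩
      have hψ' : ψ' = ψ := hS.hom_ext ψ' ψ
      have e4 : χ.x = ψ.v := congrArg CompData.Hom.v hψ'
      refine TriData.Hom.ext (congrArg CompData.Hom.u hψ') ?_ e4 (congrArg CompData.Hom.w hψ')
      apply pullback.hom_ext
      · exact χl.trans (by rw [e4]; exact hq1.symm)
      · exact e2.trans hq2.symm
  choose g hg using key
  refine ⟨R, ⟨IsTerminal.ofUniqueHom g (fun K h => (hg K).2 h trivial)⟩,
    ⟨⟨CategoryTheory.Iso.refl _, CategoryTheory.Iso.refl _, ?_, ?_, ?_⟩⟩⟩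
  · simp [R, CompData.toBispan, TriData.toBispan]
  · simp [R, CompData.toBispan, TriData.toBispan, reassoc_of% hn1]
  · simp [R, CompData.toBispan, TriData.toBispan]

/-- `F ; (G ; H)` is the outer bispan of a terminal `TriData`. -/
theorem exists_triData_right {W X Y Z : C} (F : Bispan W X) (G : Bispan X Y) (H : Bispan Y Z) :
    ∃ T : TriData F G H, Nonempty (IsTerminal T) ∧ comp F (comp G H) ≈ T.toBispan := by
  obtain ⟨hT⟩ := compData_isTerminal G H
  have hGH : comp G H = (compData G H).toBispan := rfl
  rw [hGH]
  generalize compData G H = T at hT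
  obtain ⟨hS⟩ := compData_isTerminal F T.toBispan
  have hTH : comp F T.toBispan = (compData F T.toBispan).toBispan := rfl
  rw [hTH]
  generalize compData F T.toBispan = S at hS
  have hSr : IsPullback (S.c : S.M ⟶ T.N) S.m (T.n ≫ T.m) (S.d : S.P ⟶ T.P) := S.right
  have hM := IsPullback.of_hasPullback (S.d : S.P ⟶ T.P) T.m
  let l : S.M ⟶ pullback (S.d : S.P ⟶ T.P) T.m :=
    pullback.lift S.m (S.c ≫ T.n) (by rw [← hSr.w, Category.assoc])
  have hl1 : l ≫ pullback.fst _ _ = S.m := pullback.lift_fst _ _ _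
  have hl2 : l ≫ pullback.snd _ _ = S.c ≫ T.n := pullback.lift_snd _ _ _
  have hLM : IsPullback (S.c : S.M ⟶ T.N) l T.n (pullback.snd (S.d : S.P ⟶ T.P) T.m) :=
    IsPullback.of_bot (by rw [hl1]; exact hSr) hl2.symm hM.flip
  have hSw : S.b ≫ F.t = S.c ≫ T.a ≫ G.s := S.w
  let R : TriData F G H :=
    { N := S.N, L := S.M, M := pullback (S.d : S.P ⟶ T.P) T.m, P := S.P
      n := S.n, l := l, m := pullback.fst _ _
      a := S.a, b := S.b, c := S.c ≫ T.a
      d := pullback.snd _ _ ≫ T.b, e := pullback.snd _ _ ≫ T.c, f := S.d ≫ T.d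
      pbF := S.left
      pbG := hLM.paste_horiz T.left
      pbH := hM.flip.paste_horiz T.right
      w := by rw [Category.assoc, hSw]
      w' := by rw [Category.assoc, T.w, Category.assoc] }
  have key : ∀ K : TriData F G H, ∃! g : TriData.Hom K R, True := by
    intro K
    let K1 : CompData G H := ⟨K.L, K.M, K.P, K.l, K.m, K.c, K.d, K.e, K.f, K.pbG, K.pbH, K.w'⟩
    let φ : CompData.Hom K1 T := hT.from K1
    have hφm : φ.v ≫ T.m = K.m ≫ φ.w := φ.hm
    have hφn : φ.u ≫ T.n = K.l ≫ φ.v := φ.hn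
    have hφa : φ.u ≫ T.a = K.c := φ.ha
    have hφb : φ.v ≫ T.b = K.d := φ.hb
    have hφc : φ.v ≫ T.c = K.e := φ.hc
    have hφd : φ.w ≫ T.d = K.f := φ.hd
    have sq := (φ.isPullback_left.paste_vert φ.isPullback_right)
    let K2 : CompData F T.toBispan := ⟨K.N, K.L, K.P, K.n, K.l ≫ K.m, K.a, K.b, φ.u, φ.w, K.pbF, sq,
      by
        change _ = φ.u ≫ T.a ≫ G.s
        rw [reassoc_of% hφa, K.w]⟩
    let ψ : CompData.Hom K2 S := hS.from K2
    have hψm : ψ.v ≫ S.m = (K.l ≫ K.m) ≫ ψ.w := ψ.hm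
    have hψc : ψ.v ≫ S.c = φ.u := ψ.hc
    have hψd : ψ.w ≫ S.d = φ.w := ψ.hd
    let q : K.M ⟶ pullback (S.d : S.P ⟶ T.P) T.m :=
      pullback.lift (K.m ≫ ψ.w) φ.v (by rw [Category.assoc, hψd, hφm])
    have hq1 : q ≫ pullback.fst _ _ = K.m ≫ ψ.w := pullback.lift_fst _ _ _
    have hq2 : q ≫ pullback.snd _ _ = φ.v := pullback.lift_snd _ _ _
    refine ⟨⟨ψ.u, ψ.v, q, ψ.w, ψ.hn, ?_, hq1, ψ.ha, ψ.hb, ?_, ?_, ?_, ?_⟩, trivial, ?_⟩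
    · change ψ.v ≫ l = K.l ≫ q
      apply pullback.hom_ext
      · rw [Category.assoc, Category.assoc, hl1, hq1, hψm, Category.assoc]
      · rw [Category.assoc, Category.assoc, hl2, hq2, reassoc_of% hψc, hφn]
    · change ψ.v ≫ S.c ≫ T.a = K.c
      rw [reassoc_of% hψc, hφa]
    · change q ≫ pullback.snd _ _ ≫ T.b = K.d
      rw [reassoc_of% hq2, hφb]
    · change q ≫ pullback.snd _ _ ≫ T.c = K.e
      rw [reassoc_of% hq2, hφc]
    · change ψ.w ≫ S.d ≫ T.d = K.f
      rw [reassoc_of% hψd, hφd]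
    · rintro χ -
      have χl : χ.v ≫ l = K.l ≫ χ.x := χ.hl
      have χm : χ.x ≫ pullback.fst _ _ = K.m ≫ χ.y := χ.hm
      have χc : χ.v ≫ S.c ≫ T.a = K.c := χ.hc
      have χd : χ.x ≫ pullback.snd _ _ ≫ T.b = K.d := χ.hd
      have χe : χ.x ≫ pullback.snd _ _ ≫ T.c = K.e := χ.he
      have χf : χ.y ≫ S.d ≫ T.d = K.f := χ.hf
      let φ' : CompData.Hom K1 T := ⟨χ.v ≫ S.c, χ.x ≫ pullback.snd _ _, χ.y ≫ S.d,
        by rw [Category.assoc, ← hl2, reassoc_of% χl],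
        by rw [Category.assoc, ← pullback.condition, reassoc_of% χm],
        by rw [Category.assoc, χc], by rw [Category.assoc, χd], by rw [Category.assoc, χe],
        by rw [Category.assoc, χf]⟩
      have hφ' : φ' = φ := hT.hom_ext φ' φ
      have e1 : χ.v ≫ S.c = φ.u := congrArg CompData.Hom.u hφ'
      have e2 : χ.x ≫ pullback.snd _ _ = φ.v := congrArg CompData.Hom.v hφ'
      have e3 : χ.y ≫ S.d = φ.w := congrArg CompData.Hom.w hφ'
      let ψ' : CompData.Hom K2 S := ⟨χ.u, χ.v, χ.y, χ.hn,
        by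
          change _ = (K.l ≫ K.m) ≫ χ.y
          rw [← hl1, reassoc_of% χl, χm, Category.assoc],
        χ.ha, χ.hb, e1, e3⟩
      have hψ' : ψ' = ψ := hS.hom_ext ψ' ψ
      have e4 : χ.y = ψ.w := congrArg CompData.Hom.w hψ'
      refine TriData.Hom.ext (congrArg CompData.Hom.u hψ') (congrArg CompData.Hom.v hψ') ?_ e4
      apply pullback.hom_ext
      · exact χm.trans (by rw [e4]; exact hq1.symm)
      · exact e2.trans hq2.symm
  choose g hg using key
  refine ⟨R, ⟨IsTerminal.ofUniqueHom g (fun K h => (hg K).2 h trivial)⟩,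
    ⟨⟨CategoryTheory.Iso.refl _, CategoryTheory.Iso.refl _, ?_, ?_, ?_⟩⟩⟩
  · simp [R, CompData.toBispan, TriData.toBispan]
  · simp [R, CompData.toBispan, TriData.toBispan, hl1]
  · simp [R, CompData.toBispan, TriData.toBispan]

theorem comp_assoc_equiv {W X Y Z : C} (F : Bispan W X) (G : Bispan X Y) (H : Bispan Y Z) :
    comp (comp F G) H ≈ comp F (comp G H) := by
  obtain ⟨S, ⟨hS⟩, h1⟩ := exists_triData_left F G H
  obtain ⟨T, ⟨hT⟩, h2⟩ := exists_triData_right F G H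
  exact Setoid.trans h1 (Setoid.trans (TriData.iso_of_isTerminal hS hT) (Setoid.symm h2))

end Bispan

/-- The category `P^C` of polynomials in `C`: its objects are those of `C`. -/
structure Poly (C : Type u) where
  /-- The underlying object of `C`. -/
  obj : C

/-- The morphisms of `P^C` are the isomorphism classes of bispans. -/
noncomputable instance Poly.category : Category.{max u v} (Poly C) where
  Hom X Y := Quotient (Bispan.setoid X.obj Y.obj)
  id X := ⟦Bispan.id X.obj⟧
  comp := Quotient.map₂ Bispan.comp (fun _ _ hF _ _ hG => Bispan.comp_congr hF hG)
  id_comp := by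
    rintro X Y ⟨F⟩
    exact Quotient.sound (Bispan.id_comp_equiv F)
  comp_id := by
    rintro X Y ⟨F⟩
    exact Quotient.sound (Bispan.comp_id_equiv F)
  assoc := by
    rintro W X Y Z ⟨F⟩ ⟨G⟩ ⟨H⟩
    exact Quotient.sound (Bispan.comp_assoc_equiv F G H)

/-- The morphism of `P^C` represented by a bispan. -/
def Bispan.toHom {X Y : C} (F : Bispan X Y) : Poly.mk X ⟶ Poly.mk Y :=
  (Quotient.mk (Bispan.setoid X Y) F : Quotient (Bispan.setoid X Y))

/-- The wide subgraph `P^C_D` of `P^C`, the polynomials in `C` with exponents in `D`: the classes of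
bispans `X <- E -p-> B -> Y` with `p` in `D`. -/
def polynomialsWithExponentsIn (D : MorphismProperty C) : MorphismProperty (Poly C) :=
  fun X Y f => ∃ F : Bispan X.obj Y.obj, D F.p ∧ F.toHom = f

end Bispans

end Polynomials

namespace Polynomials

variable {C : Type u} [Category.{v} C] [HasPullbacks C]

/-! The middle map of a composite bispan is built from the two given middle maps by base change and
composition alone. For `F = (X <- E -p-> B -> Y)` and `G = (Y <- E' -p'-> B' -> Z)` it is `N -> M ->
P`. Here `N = E ×_B M`, so `N -> M` is a base change of `p`; and `M = P ×_{B'} E'`, so `M -> P` is a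
base change of `p'`. A class of maps that is closed under composition and stable under pullback
therefore contains `N -> P` as soon as it contains `p` and `p'`.

The dependent product enters only through its object `P` over `B'`, along which `p'` is pulled back.
The class `D` need not be stable under `Π`, and the universal property of `P` plays no role in this
step. That property is what makes `P^C` a category in the first place: composites are terminal among
factorizations with cartesian squares, so composition is well defined on isomorphism classes, unital
and associative.

Exponentiable maps are themselves closed under composition and base change, and `exponentiable_comp`
is this same argument for that class. So the composite bispan is both exponentiable and in `D` in
its middle map, and no interaction between the two conditions has to be checked. In the locally
Cartesian closed case exponentiability is automatic, and only the condition of lying in `D` remains.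
-/

/-- The middle map of a composite of bispans lies in every multiplicative, pullback stable class
that contains the two middle maps. -/
theorem Bispan.comp_p_mem (D : MorphismProperty C) [D.IsMultiplicative]
    [D.IsStableUnderBaseChange] {X Y Z : C} {F : Bispan X Y} {G : Bispan Y Z}
    (hF : D F.p) (hG : D G.p) : D (Bispan.comp F G).p :=
  D.comp_mem _ _
    -- The square with corners `N`, `E`, `M`, `B`, whose lower side `M -> B` is the evaluation map
    -- followed by the projection from `B ×_Y E'`.
    (D.of_isPullback (IsPullback.of_hasPullback F.p
      (Bispan.compEps F G ≫ pullback.fst F.t G.s)) hF)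
    -- The outer rectangle of the exponential diagram: the evaluation map followed by the projection
    -- to `E'` is the pullback projection `M -> E'`, so the whole rectangle is cartesian over `p'`.
    (D.of_isPullback (Bispan.isExpDiagram_comp F G).isPullback hG)

/-- A morphism of `P^C` belongs to the subgraph when some representing bispan has its middle map in
`D`, so it suffices to choose good representatives and compose those. Nothing is lost by asking for
one representative only: an isomorphism of bispans gives a cartesian square between the middle maps,
so pullback stability carries membership in `D` to every other representative. -/
theorem polynomialsWithExponentsIn_isMultiplicative (D : MorphismProperty C) [D.IsMultiplicative]
    [D.IsStableUnderBaseChange] : (polynomialsWithExponentsIn D).IsMultiplicative where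
  -- The identity class is represented by the bispan of identities, whose middle map lies in `D`
  -- because `D` is wide.
  id_mem X := ⟨Bispan.id X.obj, D.id_mem X.obj, rfl⟩
  comp_mem := by
    rintro X Y Z _ _ ⟨F, hF, rfl⟩ ⟨G, hG, rfl⟩
    -- Composition in `P^C` is induced on quotients by `Bispan.comp`, so on chosen representatives
    -- it computes definitionally; hence `rfl`.
    exact ⟨Bispan.comp F G, Bispan.comp_p_mem D hF hG, rfl⟩

/-- Exponentiability is a proposition, and here it holds for every map, so a bispan carries no more
information than its underlying diagram. -/
theorem polynomialsWithExponentsIn_iff_of_isLocallyCartesianClosed (D : MorphismProperty C)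
    (hC : IsLocallyCartesianClosed C) {X Y : Poly C} (f : X ⟶ Y) :
    polynomialsWithExponentsIn D f ↔
      ∃ (S T : C) (h : S ⟶ X.obj) (g : S ⟶ T) (k : T ⟶ Y.obj),
        D g ∧ (Bispan.ofLCC hC h g k).toHom = f := by
  constructor
  · rintro ⟨F, hF, hf⟩
    -- Rebuilding `F` from its underlying diagram changes only the proof of exponentiability, so the
    -- result is definitionally `F` and `hf` applies unchanged.
    exact ⟨F.E, F.B, F.s, F.p, F.t, hF, hf⟩
  · rintro ⟨S, T, h, g, k, hg, hf⟩
    exact ⟨Bispan.ofLCC hC h g k, hg, hf⟩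

end Polynomials

/-- A wide subcategory is encoded as a multiplicative `MorphismProperty`, both for `D` in `C` and
for the resulting class in `P^C`. The first part needs only pullbacks in `C`, and so covers the
locally Cartesian closed case too; the second part says which diagrams represent the morphisms
there. -/
theorem mainTheorem2 {C : Type u} [Category.{v} C] [HasPullbacks C] (D : MorphismProperty C)
    [D.IsMultiplicative] [D.IsStableUnderBaseChange] :
    (Polynomials.polynomialsWithExponentsIn D).IsMultiplicative ∧
      ∀ (hC : Polynomials.IsLocallyCartesianClosed C) {X Y : Polynomials.Poly C} (f : X ⟶ Y),
        Polynomials.polynomialsWithExponentsIn D f ↔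
          ∃ (S T : C) (h : S ⟶ X.obj) (g : S ⟶ T) (k : T ⟶ Y.obj),
            D g ∧ (Polynomials.Bispan.ofLCC hC h g k).toHom = f :=
  ⟨Polynomials.polynomialsWithExponentsIn_isMultiplicative D, fun hC _ _ f =>
    Polynomials.polynomialsWithExponentsIn_iff_of_isLocallyCartesianClosed D hC f⟩
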